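/- A $2$-colored graph is a triple $H=(V,E_r,E_b)$ with $V$ a finite set and $E_r,E_b\subseteq\binom V2$ (the red and the blue edges, not necessarily disjoint); it is proper if $E_r\neq\emptyset$ and $E_b\neq\emptyset$, and bipartite if it contains no odd cycle all of whose edges have the same color. $G$ contains $H$ if there is an injective map $V(H)\to V(G)$ sending red edges to red edges and blue edges to blue edges; $G$ is $H$-colorable if there is a (not necessarily injective) map $V(G)\to V(H)$ sending red edges to red edges and blue edges to blue edges. The Turán density of $H$ is $$\pi(H)=\lim_{n\to\infty}\max_{G}\frac{|E_r(G)|+|E_b(G)|}{\binom n2},$$ where the maximum is over all $2$-colored graphs $G$ on $n$ vertices that do not contain $H$. Let $T$ be the $2$-colored graph with vertex set $\{1,2,3,4\}$, red edges $12,13,34$ and blue edges $12,23,34$. Let $H_8$ be the $2$-colored graph with vertex set $\{1,\dots,8\}$, red edges $12,13,24,34,16,37,48,25,35,18,46,27$ and blue edges $56,57,68,78,26,15,47,38,35,18,46,27$. **Theorem.** Let $H$ be a proper $2$-colored graph. Then the limit defining $\pi(H)$ exists, and if $H$ is bipartite, then $\pi(H)\in\{1,\tfrac43,\tfrac32\}$.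 Moreover: 1. $H$ is degenerate, i.e. $\pi(H)=1$, if and only if $H$ is $T$-colorable. 2. If $\pi(H)=\tfrac43$, then $H$ is $H_8$-colorable but not $T$-colorable. 3. If $H$ is bipartite and $\pi(H)=\tfrac32$, then $H$ is not $H_8$-colorable. -/

import Mathlib

/-- A 2-edge-colored graph on the vertex set `V`: a set of red edges and a set of blue edges
(unordered pairs of distinct vertices), not necessarily disjoint. -/
@[ext]
structure TwoColoredGraph (V : Type*) where
  /-- The graph of red edges. -/
  red : SimpleGraph V
  /-- The graph of blue edges. -/
  blue : SimpleGraph V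

namespace TwoColoredGraph

/-- There is at least one edge of each color. -/
def Proper {V : Type*} (H : TwoColoredGraph V) : Prop :=
  H.red.edgeSet.Nonempty ∧ H.blue.edgeSet.Nonempty

/-- There is no odd cycle all of whose edges are red, and none all of whose edges are blue. -/
def Bipartite {V : Type*} (H : TwoColoredGraph V) : Prop :=
  (∀ (v : V) (c : H.red.Walk v v), c.IsCycle → ¬ Odd c.length) ∧
    ∀ (v : V) (c : H.blue.Walk v v), c.IsCycle → ¬ Odd c.length

/-- The map `f` sends red edges to red edges and blue edges to blue edges. -/
def IsHom {V W : Type*} (G : TwoColoredGraph V) (H : TwoColoredGraph W) (f : V → W) : Prop :=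
  (∀ u v, G.red.Adj u v → H.red.Adj (f u) (f v)) ∧
    ∀ u v, G.blue.Adj u v → H.blue.Adj (f u) (f v)

/-- `G.ColorableBy H`: the graph `G` is `H`-colorable, i.e. there is a homomorphism from `G`
to `H`. -/
def ColorableBy {V W : Type*} (G : TwoColoredGraph V) (H : TwoColoredGraph W) : Prop :=
  ∃ f : V → W, G.IsHom H f

/-- `G.Contains H`: the graph `G` has a (not necessarily induced) sub-graph that is a copy
of `H`. -/
def Contains {V W : Type*} (G : TwoColoredGraph V) (H : TwoColoredGraph W) : Prop :=
  ∃ f : W → V, Function.Injective f ∧ H.IsHom G f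

/-- The edge density `(|E_r(G)| + |E_b(G)|) / (n choose 2)` of a graph on `n` vertices. -/
noncomputable def density {n : ℕ} (G : TwoColoredGraph (Fin n)) : ℝ :=
  ((G.red.edgeSet.ncard : ℝ) + (G.blue.edgeSet.ncard : ℝ)) / (n.choose 2 : ℝ)

/-- The maximum edge density of an `H`-free 2-colored graph on `n` vertices. The set is finite,
and if `H` has an edge it is nonempty. -/
noncomputable def maxDensity {V : Type*} (H : TwoColoredGraph V) (n : ℕ) : ℝ :=
  sSup {d : ℝ | ∃ G : TwoColoredGraph (Fin n), ¬ G.Contains H ∧ G.density = d}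

/-- The Turán density of `H`, the limit of the maximum density of `H`-free graphs on `n`
vertices as `n` tends to infinity. -/
noncomputable def turanDensity {V : Type*} (H : TwoColoredGraph V) : ℝ :=
  Filter.limUnder Filter.atTop H.maxDensity

/-- A graph is degenerate if its Turán density is 1. -/
def Degenerate {V : Type*} (H : TwoColoredGraph V) : Prop :=
  H.turanDensity = 1

/-- The graph on `{1, 2, 3, 4}` with red edges 12, 13, 34 and blue edges 12, 23, 34;
the vertex `i` is represented by `i - 1 : Fin 4`. -/
def T : TwoColoredGraph (Fin 4) where
  red := SimpleGraph.fromEdgeSet {s(0, 1), s(0, 2), s(2, 3)}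
  blue := SimpleGraph.fromEdgeSet {s(0, 1), s(1, 2), s(2, 3)}

/-- The graph on `{1, ..., 8}` with red edges 12, 13, 24, 34, 16, 37, 48, 25, 35, 18, 46, 27 and
blue edges 56, 57, 68, 78, 26, 15, 47, 38, 35, 18, 46, 27;
the vertex `i` is represented by `i - 1 : Fin 8`. -/
def H₈ : TwoColoredGraph (Fin 8) where
  red := SimpleGraph.fromEdgeSet
    {s(0, 1), s(0, 2), s(1, 3), s(2, 3), s(0, 5), s(2, 6), s(3, 7), s(1, 4),
      s(2, 4), s(0, 7), s(3, 5), s(1, 6)}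
  blue := SimpleGraph.fromEdgeSet
    {s(4, 5), s(4, 6), s(5, 7), s(6, 7), s(1, 5), s(0, 4), s(3, 6), s(2, 7),
      s(2, 4), s(0, 7), s(3, 5), s(1, 6)}

end TwoColoredGraph

/-!
For the lower bounds, let `P` be a small 2-colored graph with loops. If `H` has no homomorphism to
`P`, then the random blow-ups of `P` do not contain `H`, so `π(H)` is at least the edge density of
`P`. The graph `T` is the product of a pattern of density `4 / 3` and its color swap, and `H₈` is
the product of three patterns of density `3 / 2`; hence a graph that is not `T`-colorable (not
`H₈`-colorable) misses a pattern of density `4 / 3` (of density `3 / 2`).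

For the upper bounds, deleting vertices of low degree reduces density `c + ε` to minimum degree
above `c n`, where averaging over the neighborhoods of two or three vertices finds `T` if `c = 1`,
the product of a red edge and a blue edge if `c = 3 / 2`, and this product or the join of a red edge
and a blue edge if `c = 4 / 3`. By supersaturation, blowing up the forced graphs does not change
the threshold `c`, so it also forces every graph that is colorable by them: bipartite graphs are
colorable by the product, and `H₈` is colorable by both the product and the join.
-/

open Finset
open scoped BigOperators

section Expectation

variable {U V W ι M : Type*} [AddCommMonoid M] [Module ℚ≥0 M]

lemma expect_perm_trans_eq [Finite U] [Fintype W] [DecidableEq W] (F : (U ↪ W) → M)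
    (e e' : U ↪ W) :
    𝔼 σ : Equiv.Perm W, F (e.trans σ.toEmbedding)
      = 𝔼 σ : Equiv.Perm W, F (e'.trans σ.toEmbedding) := by
  obtain ⟨τ, hτ⟩ := Equiv.Perm.exists_extending_pair e' e e'.injective e.injective
  refine Fintype.expect_equiv (Equiv.mulRight τ) _ _ fun σ => congrArg F ?_
  ext x
  simp [hτ]

lemma expect_perm_trans [Fintype U] [Fintype W] [DecidableEq W]
    (F : (U ↪ W) → M) (e : U ↪ W) :
    𝔼 σ : Equiv.Perm W, F (e.trans σ.toEmbedding) = 𝔼 e' : U ↪ W, F e' := by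
  have : Nonempty (U ↪ W) := ⟨e⟩
  have hinv (σ : Equiv.Perm W) :
      𝔼 e' : U ↪ W, F (e'.trans σ.toEmbedding) = 𝔼 e' : U ↪ W, F e' :=
    Fintype.expect_equiv (Equiv.embeddingCongr (Equiv.refl U) σ) _ _ fun _ => rfl
  calc 𝔼 σ : Equiv.Perm W, F (e.trans σ.toEmbedding)
      = 𝔼 e' : U ↪ W, 𝔼 σ : Equiv.Perm W, F (e'.trans σ.toEmbedding) := by
        simp only [expect_perm_trans_eq F _ e, Fintype.expect_const]
    _ = 𝔼 σ : Equiv.Perm W, 𝔼 e' : U ↪ W, F (e'.trans σ.toEmbedding) := expect_comm ..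
    _ = 𝔼 e' : U ↪ W, F e' := by simp only [hinv, Fintype.expect_const]

lemma expect_trans_embedding [Fintype U] [Fintype V] [Fintype W] [Nonempty (V ↪ W)]
    (F : (U ↪ W) → M) (d : U ↪ V) : 𝔼 e : V ↪ W, F (d.trans e) = 𝔼 e : U ↪ W, F e := by
  classical
  obtain ⟨e₀⟩ := ‹Nonempty (V ↪ W)›
  rw [← expect_perm_trans (fun e => F (d.trans e)) e₀, ← expect_perm_trans F (d.trans e₀)]
  rfl

variable [Fintype V] [DecidableEq V] [Fintype ι]

lemma expect_pi_split (x : V) (F : ι → ({y // y ≠ x} → ι) → M) :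
    𝔼 p : V → ι, F (p x) (fun y => p y) = 𝔼 i, 𝔼 q, F i q := by
  rw [← expect_product' univ univ F, univ_product_univ]
  exact Fintype.expect_equiv (Equiv.funSplitAt x ι) _ _ fun _ => rfl

lemma expect_pi_apply [Nonempty ι] (x : V) (f : ι → M) : 𝔼 p : V → ι, f (p x) = 𝔼 i, f i := by
  simpa only [Fintype.expect_const] using expect_pi_split x fun i _ => f i

lemma expect_pi_apply_apply [Nonempty ι] {x y : V} (hxy : x ≠ y) (f : ι → ι → M) :
    𝔼 p : V → ι, f (p x) (p y) = 𝔼 i, 𝔼 j, f i j := by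
  simpa only [expect_pi_apply] using expect_pi_split x fun i q => f i (q ⟨y, hxy.symm⟩)

end Expectation

namespace TwoColoredGraph

section Weight

variable {V : Type*} (G : TwoColoredGraph V)

open scoped Classical in
/-- The number of edges (`0`, `1` or `2`) of `G` joining `x` and `y`. -/
noncomputable def weight (x y : V) : ℕ :=
  (if G.red.Adj x y then 1 else 0) + if G.blue.Adj x y then 1 else 0

lemma weight_comm (x y : V) : G.weight x y = G.weight y x := by
  classical
  exact congrArg₂ (· + ·) (if_congr (G.red.adj_comm x y) rfl rfl)
    (if_congr (G.blue.adj_comm x y) rfl rfl)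

@[simp]
lemma weight_self (x : V) : G.weight x x = 0 := by
  simp [weight]

lemma weight_le_two (x y : V) : G.weight x y ≤ 2 := by
  unfold weight
  split_ifs <;> simp

lemma two_le_weight {x y : V} : 2 ≤ G.weight x y ↔ G.red.Adj x y ∧ G.blue.Adj x y := by
  unfold weight
  split_ifs <;> simp_all

lemma one_le_weight {x y : V} : 1 ≤ G.weight x y ↔ G.red.Adj x y ∨ G.blue.Adj x y := by
  unfold weight
  split_ifs <;> simp_all

end Weight

section Maps

variable {U V W : Type*}

/-- The pullback of a 2-colored graph along a map `f`; it is an induced subgraph if `f` is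
injective, and a blow-up (some of whose classes may be empty) in general. -/
def comap (f : V → W) (G : TwoColoredGraph W) : TwoColoredGraph V where
  red := G.red.comap f
  blue := G.blue.comap f

lemma weight_comap (f : V → W) (G : TwoColoredGraph W) (x y : V) :
    (G.comap f).weight x y = G.weight (f x) (f y) :=
  rfl

lemma comap_comap (f : V → W) (g : U → V) (G : TwoColoredGraph W) :
    (G.comap f).comap g = G.comap (f ∘ g) :=
  rfl

lemma isHom_comap (f : V → W) (G : TwoColoredGraph W) : (G.comap f).IsHom G f :=
  ⟨fun _ _ h => h, fun _ _ h => h⟩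

variable {F : TwoColoredGraph U} {G : TwoColoredGraph V} {H : TwoColoredGraph W}

lemma IsHom.comp {g : V → W} {f : U → V} (hg : G.IsHom H g) (hf : F.IsHom G f) :
    F.IsHom H (g ∘ f) :=
  ⟨fun _ _ h => hg.1 _ _ (hf.1 _ _ h), fun _ _ h => hg.2 _ _ (hf.2 _ _ h)⟩

lemma ColorableBy.trans (h₁ : F.ColorableBy G) (h₂ : G.ColorableBy H) : F.ColorableBy H := by
  obtain ⟨f, hf⟩ := h₁
  obtain ⟨g, hg⟩ := h₂
  exact ⟨g ∘ f, hg.comp hf⟩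

lemma Contains.trans (h₁ : H.Contains G) (h₂ : G.Contains F) : H.Contains F := by
  obtain ⟨g, hg, hg'⟩ := h₁
  obtain ⟨f, hf, hf'⟩ := h₂
  exact ⟨g ∘ f, hg.comp hf, hg'.comp hf'⟩

lemma contains_comap {f : V → W} (hf : f.Injective) (H : TwoColoredGraph W) :
    H.Contains (H.comap f) :=
  ⟨f, hf, isHom_comap f H⟩

end Maps

section Density

variable {m n : ℕ} (G : TwoColoredGraph (Fin n))

lemma sum_adj_eq_two_mul_ncard {V : Type*} [Fintype V] (K : SimpleGraph V) [DecidableRel K.Adj] :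
    ∑ x, ∑ y, (if K.Adj x y then 1 else 0) = 2 * K.edgeSet.ncard := by
  classical
  rw [← SimpleGraph.coe_edgeFinset, Set.ncard_coe_finset,
    ← SimpleGraph.sum_degrees_eq_twice_card_edges]
  refine sum_congr rfl fun x _ => ?_
  rw [← SimpleGraph.card_neighborFinset_eq_degree, SimpleGraph.neighborFinset_eq_filter,
    card_filter]

lemma density_eq_sum_div : G.density = (∑ x, ∑ y, (G.weight x y : ℝ)) / (n * (n - 1)) := by
  classical
  have hsum : ∑ x, ∑ y, G.weight x y = 2 * (G.red.edgeSet.ncard + G.blue.edgeSet.ncard) := by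
    simp only [weight, sum_add_distrib]
    rw [sum_adj_eq_two_mul_ncard, sum_adj_eq_two_mul_ncard, mul_add]
  have hsum' : ∑ x, ∑ y, (G.weight x y : ℝ)
      = 2 * ((G.red.edgeSet.ncard : ℝ) + G.blue.edgeSet.ncard) := by
    exact_mod_cast hsum
  rw [density, hsum', Nat.cast_choose_two, div_div_eq_mul_div, mul_comm]

lemma sum_sum_weight_eq_sum_embedding :
    ∑ x, ∑ y, (G.weight x y : ℝ) = ∑ e : Fin 2 ↪ Fin n, (G.weight (e 0) (e 1) : ℝ) := by
  rw [← sum_product', univ_product_univ]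
  refine (sum_of_injOn (fun e : Fin 2 ↪ Fin n => (e 0, e 1)) ?_ (by simp) ?_ fun _ _ => rfl).symm
  · intro e _ e' _ h
    simpa using Function.Embedding.twoEmbeddingEquiv.injective (Subtype.ext h)
  · rintro ⟨x, y⟩ - hxy
    suffices x = y by simp [this]
    by_contra hne
    exact hxy ⟨Function.Embedding.embFinTwo hne, mem_coe.2 (mem_univ _), rfl⟩

lemma density_eq_expect : G.density = 𝔼 e : Fin 2 ↪ Fin n, (G.weight (e 0) (e 1) : ℝ) := by
  rw [density_eq_sum_div, sum_sum_weight_eq_sum_embedding, Fintype.expect_eq_sum_div_card,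
    Fintype.card_embedding_eq, Fintype.card_fin, Fintype.card_fin, Nat.cast_descFactorial_two]

lemma density_nonneg : 0 ≤ G.density := by
  unfold density
  positivity

lemma density_le_two : G.density ≤ 2 := by
  rw [density_eq_expect]
  rcases isEmpty_or_nonempty (Fin 2 ↪ Fin n) with _ | _
  · simp
  · exact expect_le univ_nonempty fun e _ => by exact_mod_cast G.weight_le_two _ _

lemma expect_density_comap (hm : 2 ≤ m) (hmn : m ≤ n) :
    𝔼 e : Fin m ↪ Fin n, (G.comap e).density = G.density := by
  have : Nonempty (Fin m ↪ Fin n) := ⟨Fin.castLEEmb hmn⟩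
  simp only [density_eq_expect, weight_comap]
  rw [expect_comm]
  have : Nonempty (Fin 2 ↪ Fin m) := ⟨Fin.castLEEmb hm⟩
  have hpair (d : Fin 2 ↪ Fin m) :
      𝔼 e : Fin m ↪ Fin n, (G.weight (e (d 0)) (e (d 1)) : ℝ)
        = 𝔼 e : Fin 2 ↪ Fin n, (G.weight (e 0) (e 1) : ℝ) :=
    expect_trans_embedding (fun e => (G.weight (e 0) (e 1) : ℝ)) d
  simp only [hpair, Fintype.expect_const]

end Density

section Limit

variable {V : Type*} (H : TwoColoredGraph V)

lemma density_le_maxDensity {n : ℕ} {G : TwoColoredGraph (Fin n)} (hG : ¬ G.Contains H) :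
    G.density ≤ H.maxDensity n := by
  refine le_csSup ⟨2, ?_⟩ ⟨G, hG, rfl⟩
  rintro _ ⟨G', -, rfl⟩
  exact G'.density_le_two

lemma maxDensity_le {n : ℕ} {c : ℝ} (hc : 0 ≤ c)
    (h : ∀ G : TwoColoredGraph (Fin n), ¬ G.Contains H → G.density ≤ c) :
    H.maxDensity n ≤ c := by
  refine Real.sSup_le ?_ hc
  rintro _ ⟨G, hG, rfl⟩
  exact h G hG

lemma maxDensity_nonneg (n : ℕ) : 0 ≤ H.maxDensity n := by
  refine Real.sSup_nonneg ?_
  rintro _ ⟨G, -, rfl⟩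
  exact G.density_nonneg

lemma maxDensity_anti {m n : ℕ} (hm : 2 ≤ m) (hmn : m ≤ n) :
    H.maxDensity n ≤ H.maxDensity m := by
  have : Nonempty (Fin m ↪ Fin n) := ⟨Fin.castLEEmb hmn⟩
  refine H.maxDensity_le (H.maxDensity_nonneg m) fun G hG => ?_
  rw [← G.expect_density_comap hm hmn]
  exact expect_le univ_nonempty fun e _ =>
    H.density_le_maxDensity fun hcon => hG ((contains_comap e.injective G).trans hcon)

theorem tendsto_maxDensity :
    Filter.Tendsto H.maxDensity Filter.atTop (nhds H.turanDensity) := by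
  have hlim : Filter.Tendsto (fun n => H.maxDensity (n + 2)) Filter.atTop
      (nhds (⨅ n, H.maxDensity (n + 2))) :=
    tendsto_atTop_ciInf (fun m n h => H.maxDensity_anti (by lia) (by lia))
      ⟨0, Set.forall_mem_range.2 fun n => H.maxDensity_nonneg _⟩
  exact tendsto_nhds_limUnder ⟨_, (Filter.tendsto_add_atTop_iff_nat 2).1 hlim⟩

end Limit

/-- A pattern: a 2-colored graph with loops. Blowing up its vertices to cliques (in the colors of
the loops) gives the graphs that witness the lower bounds. -/
structure Pattern (ι : Type*) where
  /-- Whether two vertices, possibly equal, are joined in red. -/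
  red : ι → ι → Bool
  /-- Whether two vertices, possibly equal, are joined in blue. -/
  blue : ι → ι → Bool
  red_comm : ∀ i j, red i j = red j i
  blue_comm : ∀ i j, blue i j = blue j i

/-- `H.Fits P`: there is a homomorphism from the 2-colored graph `H` to the pattern `P`. -/
def Fits {V ι : Type*} (H : TwoColoredGraph V) (P : Pattern ι) : Prop :=
  ∃ f : V → ι, (∀ u v, H.red.Adj u v → P.red (f u) (f v)) ∧
    ∀ u v, H.blue.Adj u v → P.blue (f u) (f v)

namespace Pattern

variable {V W ι : Type*} (P : Pattern ι)

/-- The number of edges (`0`, `1` or `2`) of `P` joining `i` and `j`. -/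
def weight (i j : ι) : ℕ :=
  (P.red i j).toNat + (P.blue i j).toNat

/-- The limit density of the balanced blow-ups of `P`. -/
noncomputable def density [Fintype ι] : ℝ :=
  𝔼 i, 𝔼 j, (P.weight i j : ℝ)

/-- The pattern with the two colors exchanged. -/
def swap : Pattern ι where
  red := P.blue
  blue := P.red
  red_comm := P.blue_comm
  blue_comm := P.red_comm

lemma density_swap [Fintype ι] : P.swap.density = P.density := by
  simp only [density, weight, swap, add_comm]

/-- The blow-up of `P` in which `x` belongs to the class of `p x`. -/
def blowup (p : W → ι) : TwoColoredGraph W where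
  red := SimpleGraph.fromRel fun x y => P.red (p x) (p y)
  blue := SimpleGraph.fromRel fun x y => P.blue (p x) (p y)

variable {P}

lemma weight_blowup {p : W → ι} {x y : W} (hxy : x ≠ y) :
    (P.blowup p).weight x y = P.weight (p x) (p y) := by
  simp only [TwoColoredGraph.weight, blowup, SimpleGraph.fromRel_adj, P.red_comm (p y),
    P.blue_comm (p y), or_self, ne_eq, hxy, not_false_eq_true, true_and, weight, Bool.toNat,
    Bool.cond_eq_ite]

lemma not_contains_blowup {H : TwoColoredGraph V} (hH : ¬ H.Fits P) (p : W → ι) :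
    ¬ (P.blowup p).Contains H := by
  rintro ⟨f, -, hred, hblue⟩
  refine hH ⟨p ∘ f, fun u v huv => ?_, fun u v huv => ?_⟩
  · exact (hred u v huv).2.elim id (P.red_comm _ _).trans
  · exact (hblue u v huv).2.elim id (P.blue_comm _ _).trans

lemma expect_density_blowup [Fintype ι] [Nonempty ι] {n : ℕ} (hn : 2 ≤ n) :
    𝔼 p : Fin n → ι, (P.blowup p).density = P.density := by
  have : Nonempty (Fin 2 ↪ Fin n) := ⟨Fin.castLEEmb hn⟩
  have hpair (e : Fin 2 ↪ Fin n) :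
      𝔼 p : Fin n → ι, ((P.blowup p).weight (e 0) (e 1) : ℝ) = P.density := by
    have hne : e 0 ≠ e 1 := e.injective.ne zero_ne_one
    simp only [weight_blowup hne]
    exact expect_pi_apply_apply hne fun i j => (P.weight i j : ℝ)
  simp only [density_eq_expect]
  rw [expect_comm]
  simp only [hpair, Fintype.expect_const]

theorem density_le_turanDensity [Fintype ι] [Nonempty ι] {H : TwoColoredGraph V}
    (hH : ¬ H.Fits P) : P.density ≤ H.turanDensity := by
  refine ge_of_tendsto H.tendsto_maxDensity ?_
  filter_upwards [Filter.eventually_ge_atTop 2] with n hn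
  rw [← expect_density_blowup hn]
  exact expect_le univ_nonempty fun p _ => H.density_le_maxDensity (not_contains_blowup hH p)

/-- A single vertex with a red loop. -/
def redLoop : Pattern Unit where
  red _ _ := true
  blue _ _ := false
  red_comm _ _ := rfl
  blue_comm _ _ := rfl

/-- A vertex with a red loop and a vertex with a blue loop, joined in both colors. -/
def split : Pattern Bool where
  red s t := s || t
  blue s t := !s || !t
  red_comm := by decide
  blue_comm := by decide

/-- A double edge whose two vertices both have a blue loop. -/
def redBipartite : Pattern Bool where
  red s t := s != t
  blue _ _ := true
  red_comm := by decide
  blue_comm := by decide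

/-- A vertex with a red loop and a vertex without loops, joined in both colors. The first vertex
is split into the twins `0` and `1`, because `4 / 3` is the density of the blow-ups that give it
twice the weight of the second one, `2`. -/
def redCover : Pattern (Fin 3) where
  red i j := i != 2 || j != 2
  blue i j := (i == 2) != (j == 2)
  red_comm := by decide
  blue_comm := by decide

lemma density_redLoop : redLoop.density = 1 := by
  simp [density, weight, redLoop]

lemma density_split : split.density = 3 / 2 := by
  simp only [density, weight, split, Fintype.expect_eq_sum_div_card, Fintype.sum_bool,
    Fintype.card_bool]
  norm_num

lemma density_redBipartite : redBipartite.density = 3 / 2 := by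
  simp only [density, weight, redBipartite, Fintype.expect_eq_sum_div_card, Fintype.sum_bool,
    Fintype.card_bool]
  norm_num

lemma density_redCover : redCover.density = 4 / 3 := by
  have hsum : ∑ i, ∑ j, redCover.weight i j = 12 := by decide
  have hsum' : ∑ i, ∑ j, (redCover.weight i j : ℝ) = 12 := by exact_mod_cast hsum
  simp only [density, Fintype.expect_eq_sum_div_card, ← sum_div, hsum', Fintype.card_fin]
  norm_num

end Pattern

section LowerBound

variable {V : Type*} {H : TwoColoredGraph V}

instance : DecidableRel T.red.Adj := fun _ _ => by unfold T; infer_instance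

instance : DecidableRel T.blue.Adj := fun _ _ => by unfold T; infer_instance

instance : DecidableRel H₈.red.Adj := fun _ _ => by unfold H₈; infer_instance

instance : DecidableRel H₈.blue.Adj := fun _ _ => by unfold H₈; infer_instance

theorem one_le_turanDensity (hH : H.red.edgeSet.Nonempty ∨ H.blue.edgeSet.Nonempty) :
    1 ≤ H.turanDensity := by
  rcases hH with ⟨⟨u, v⟩, huv⟩ | ⟨⟨u, v⟩, huv⟩
  · rw [← Pattern.density_redLoop, ← Pattern.density_swap]
    exact Pattern.density_le_turanDensity fun ⟨_, hred, _⟩ => Bool.false_ne_true (hred u v huv)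
  · rw [← Pattern.density_redLoop]
    exact Pattern.density_le_turanDensity fun ⟨_, _, hblue⟩ => Bool.false_ne_true (hblue u v huv)

/-- `T` is the product of the two patterns with `0` and `1` identified. -/
lemma colorableBy_T_of_fits (hred : H.Fits Pattern.redCover)
    (hblue : H.Fits Pattern.redCover.swap) : H.ColorableBy T := by
  obtain ⟨f, hfr, hfb⟩ := hred
  obtain ⟨g, hgr, hgb⟩ := hblue
  let q (i j : Fin 3) : Fin 4 := if i = 2 then if j = 2 then 3 else 1 else if j = 2 then 0 else 2
  have hqr : ∀ i j i' j', Pattern.redCover.red i i' → Pattern.redCover.blue j j' →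
      T.red.Adj (q i j) (q i' j') := by decide
  have hqb : ∀ i j i' j', Pattern.redCover.blue i i' → Pattern.redCover.red j j' →
      T.blue.Adj (q i j) (q i' j') := by decide
  exact ⟨fun v => q (f v) (g v), fun u v h => hqr _ _ _ _ (hfr u v h) (hgr u v h),
    fun u v h => hqb _ _ _ _ (hfb u v h) (hgb u v h)⟩

/-- `H₈` is the product of the three patterns. -/
lemma colorableBy_H₈_of_fits (hsplit : H.Fits Pattern.split) (hred : H.Fits Pattern.redBipartite)
    (hblue : H.Fits Pattern.redBipartite.swap) : H.ColorableBy H₈ := by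
  obtain ⟨s, hsr, hsb⟩ := hsplit
  obtain ⟨r, hr, -⟩ := hred
  obtain ⟨b, -, hb⟩ := hblue
  let q : Bool → Bool → Bool → Fin 8
    | true, true, true => 2
    | true, true, false => 1
    | true, false, true => 0
    | true, false, false => 3
    | false, true, true => 5
    | false, true, false => 7
    | false, false, true => 6
    | false, false, false => 4
  have hqr : ∀ s r b s' r' b', Pattern.split.red s s' → Pattern.redBipartite.red r r' →
      H₈.red.Adj (q s r b) (q s' r' b') := by decide
  have hqb : ∀ s r b s' r' b', Pattern.split.blue s s' → Pattern.redBipartite.red b b' →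
      H₈.blue.Adj (q s r b) (q s' r' b') := by decide
  exact ⟨fun v => q (s v) (r v) (b v), fun u v h => hqr _ _ _ _ _ _ (hsr u v h) (hr u v h),
    fun u v h => hqb _ _ _ _ _ _ (hsb u v h) (hb u v h)⟩

theorem four_thirds_le_turanDensity (hH : ¬ H.ColorableBy T) : 4 / 3 ≤ H.turanDensity := by
  by_cases hred : H.Fits Pattern.redCover
  · rw [← Pattern.density_redCover, ← Pattern.density_swap]
    exact Pattern.density_le_turanDensity fun hblue => hH (colorableBy_T_of_fits hred hblue)
  · exact Pattern.density_redCover ▸ Pattern.density_le_turanDensity hred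

theorem three_halves_le_turanDensity (hH : ¬ H.ColorableBy H₈) : 3 / 2 ≤ H.turanDensity := by
  by_cases hsplit : H.Fits Pattern.split
  · by_cases hred : H.Fits Pattern.redBipartite
    · rw [← Pattern.density_redBipartite, ← Pattern.density_swap]
      exact Pattern.density_le_turanDensity fun hblue =>
        hH (colorableBy_H₈_of_fits hsplit hred hblue)
    · exact Pattern.density_redBipartite ▸ Pattern.density_le_turanDensity hred
  · exact Pattern.density_split ▸ Pattern.density_le_turanDensity hsplit

end LowerBound

section Supersaturation

variable {U V W : Type*}

/-- Every sufficiently large graph whose density exceeds `c` by a fixed constant contains `K₁` or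
`K₂`. -/
def ForcedAbove (c : ℝ) (K₁ : TwoColoredGraph V) (K₂ : TwoColoredGraph W) : Prop :=
  ∀ ε > 0, ∀ᶠ n in Filter.atTop, ∀ G : TwoColoredGraph (Fin n),
    c + ε < G.density → G.Contains K₁ ∨ G.Contains K₂

open scoped Classical in
/-- The probability that a random injection of the vertices of `K` into those of `G` maps `K` to
a copy of `K` in `G`. -/
noncomputable def copyDensity [Fintype V] [Fintype W] (K : TwoColoredGraph V)
    (G : TwoColoredGraph W) : ℝ :=
  𝔼 e : V ↪ W, if K.IsHom G e then 1 else 0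

/-- The graph obtained from `K` by adding a twin `none` of the vertex `u`, not joined to `u`. -/
def addTwin (K : TwoColoredGraph V) (u : V) : TwoColoredGraph (Option V) :=
  K.comap fun x => x.getD u

lemma contains_addTwin {K : TwoColoredGraph V} {G : TwoColoredGraph W} {u : V} {e e' : V ↪ W}
    (he : K.IsHom G e) (he' : K.IsHom G e') (heq : ∀ x ≠ u, e x = e' x) (hne : e u ≠ e' u) :
    G.Contains (K.addTwin u) := by
  let f (x : Option V) : W := x.elim (e' u) e
  have hadj {A : SimpleGraph V} {B : SimpleGraph W} (h : ∀ x y, A.Adj x y → B.Adj (e x) (e y))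
      (h' : ∀ x y, A.Adj x y → B.Adj (e' x) (e' y)) :
      ∀ x y : Option V, A.Adj (x.getD u) (y.getD u) → B.Adj (f x) (f y)
    | none, none, hxy => (A.irrefl hxy).elim
    | none, some y, hxy => by
      have := h' u y hxy
      rwa [← heq y hxy.ne'] at this
    | some x, none, hxy => by
      have := h' x u hxy
      rwa [← heq x hxy.ne] at this
    | some x, some y, hxy => h x y hxy
  refine ⟨f, Option.injective_iff.2 ⟨e.injective, ?_⟩, hadj he.1 he'.1, hadj he.2 he'.2⟩
  rintro ⟨x, hx : e x = e' u⟩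
  by_cases hxu : x = u
  · exact hne (hxu ▸ hx)
  · exact hxu (e'.injective (heq x hxu ▸ hx))

section CopyDensity

variable [Fintype V] [Fintype W] {K : TwoColoredGraph V} {G : TwoColoredGraph W}

lemma copyDensity_nonneg : 0 ≤ K.copyDensity G :=
  expect_nonneg fun _ _ => by split_ifs <;> simp

open scoped Classical in
lemma copyDensity_eq_card_div :
    K.copyDensity G = #{e : V ↪ W | K.IsHom G e} / Fintype.card (V ↪ W) := by
  rw [copyDensity, Fintype.expect_eq_sum_div_card, sum_boole]

lemma one_le_card_mul_copyDensity (h : G.Contains K) :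
    1 ≤ Fintype.card (V ↪ W) * K.copyDensity G := by
  classical
  obtain ⟨f, hf, hK⟩ := h
  have hcard : 0 < Fintype.card (V ↪ W) := Fintype.card_pos_iff.2 ⟨⟨f, hf⟩⟩
  have hpos : 0 < #{e : V ↪ W | K.IsHom G e} :=
    card_pos.2 ⟨⟨f, hf⟩, mem_filter.2 ⟨mem_univ _, hK⟩⟩
  rw [copyDensity_eq_card_div, mul_div_cancel₀ _ (by positivity)]
  exact_mod_cast hpos

lemma expect_copyDensity_comap [Fintype U] [Nonempty (V ↪ U)] [Nonempty (U ↪ W)] :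
    𝔼 e : U ↪ W, K.copyDensity (G.comap e) = K.copyDensity G := by
  classical
  have hcopy (d : V ↪ U) : 𝔼 e : U ↪ W, (if K.IsHom (G.comap e) d then 1 else 0 : ℝ)
      = K.copyDensity G :=
    expect_trans_embedding (fun e => if K.IsHom G e then 1 else 0) d
  simp only [copyDensity] at hcopy ⊢
  rw [expect_comm]
  simp only [hcopy, Fintype.expect_const]

open scoped Classical in
/-- A homomorphic embedding of `K` is determined by its restriction to `{u}ᶜ`, since two
embeddings that only differ at `u` form a copy of `K.addTwin u`. -/
lemma card_isHom_le {u : V} (hG : ¬ G.Contains (K.addTwin u)) :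
    #{e : V ↪ W | K.IsHom G e} ≤ Fintype.card ({x // x ≠ u} ↪ W) := by
  refine card_le_card_of_injOn (t := univ) (fun e => (Function.Embedding.subtype _).trans e)
    (fun _ _ => mem_coe.2 (mem_univ _)) fun e he e' he' hres => ?_
  have heq (x : V) (hx : x ≠ u) : e x = e' x :=
    DFunLike.congr_fun hres (⟨x, hx⟩ : {x // x ≠ u})
  have hu : e u = e' u := by
    by_contra hne
    exact hG (contains_addTwin (mem_filter.1 he).2 (mem_filter.1 he').2 heq hne)
  ext x
  by_cases hx : x = u
  · rw [hx, hu]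
  · exact heq x hx

lemma sub_card_mul_copyDensity_le_one {u : V} (hG : ¬ G.Contains (K.addTwin u)) :
    ((Fintype.card W - Fintype.card V : ℕ) : ℝ) * K.copyDensity G ≤ 1 := by
  classical
  have hV : Fintype.card V = Fintype.card {x // x ≠ u} + 1 := by
    rw [Fintype.card_subtype_compl, Fintype.card_subtype_eq,
      Nat.sub_add_cancel (Fintype.card_pos_iff.2 ⟨u⟩)]
  have hcount : (Fintype.card W - Fintype.card V) * #{e : V ↪ W | K.IsHom G e}
      ≤ Fintype.card (V ↪ W) := by
    have h := card_isHom_le hG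
    rw [Fintype.card_embedding_eq] at h ⊢
    rw [hV, Nat.descFactorial_succ]
    exact Nat.mul_le_mul (by lia) h
  rw [copyDensity_eq_card_div, mul_div_assoc']
  exact div_le_one_of_le₀ (by exact_mod_cast hcount) (by positivity)

end CopyDensity

lemma eventually_copyDensity_le [Fintype V] (K : TwoColoredGraph V) (u : V) {δ : ℝ} (hδ : 0 < δ) :
    ∀ᶠ n in Filter.atTop, ∀ G : TwoColoredGraph (Fin n),
      ¬ G.Contains (K.addTwin u) → K.copyDensity G ≤ δ := by
  obtain ⟨N, hN⟩ := exists_nat_gt (1 / δ)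
  filter_upwards [Filter.eventually_ge_atTop (N + Fintype.card V)] with n hn G hG
  have hle := sub_card_mul_copyDensity_le_one hG
  rw [Fintype.card_fin] at hle
  have hNn : (N : ℝ) ≤ ((n - Fintype.card V : ℕ) : ℝ) := by exact_mod_cast Nat.le_sub_of_add_le hn
  by_contra! hlt
  refine hle.not_gt ?_
  calc 1 < N * δ := (div_lt_iff₀ hδ).1 hN
    _ ≤ ((n - Fintype.card V : ℕ) : ℝ) * K.copyDensity G := by gcongr

lemma density_le_add_copyDensity [Fintype V] {m n : ℕ} (hm : 2 ≤ m) (hmn : m ≤ n)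
    [Nonempty (V ↪ Fin m)] {K : TwoColoredGraph V} {G : TwoColoredGraph (Fin n)} {a : ℝ}
    (h : ∀ e : Fin m ↪ Fin n, ¬ (G.comap e).Contains K → (G.comap e).density ≤ a) :
    G.density ≤ a + (2 + |a|) * (Fintype.card (V ↪ Fin m) * K.copyDensity G) := by
  have : Nonempty (Fin m ↪ Fin n) := ⟨Fin.castLEEmb hmn⟩
  have hle (e : Fin m ↪ Fin n) : (G.comap e).density
      ≤ a + (2 + |a|) * (Fintype.card (V ↪ Fin m) * K.copyDensity (G.comap e)) := by
    by_cases hK : (G.comap e).Contains K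
    · have h1 := one_le_card_mul_copyDensity hK
      have h2 := (G.comap e).density_le_two
      nlinarith [neg_abs_le a, abs_nonneg a]
    · have : 0 ≤ K.copyDensity (G.comap e) := copyDensity_nonneg
      exact (h e hK).trans (le_add_of_nonneg_right (by positivity))
  calc G.density = 𝔼 e : Fin m ↪ Fin n, (G.comap e).density := (G.expect_density_comap hm hmn).symm
    _ ≤ 𝔼 e : Fin m ↪ Fin n,
        (a + (2 + |a|) * (Fintype.card (V ↪ Fin m) * K.copyDensity (G.comap e))) :=
      expect_le_expect fun e _ => hle e
    _ = a + (2 + |a|) * (Fintype.card (V ↪ Fin m) * K.copyDensity G) := by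
      rw [expect_add_distrib, Fintype.expect_const, ← mul_expect, ← mul_expect,
        expect_copyDensity_comap]

namespace ForcedAbove

variable {c : ℝ} {K : TwoColoredGraph U} {H : TwoColoredGraph V} {L : TwoColoredGraph W}

lemma symm (h : ForcedAbove c K L) : ForcedAbove c L K := fun ε hε =>
  (h ε hε).mono fun _ hn G hG => (hn G hG).symm

lemma of_contains (h : ForcedAbove c K L) (hK : K.Contains H) : ForcedAbove c H L := fun ε hε =>
  (h ε hε).mono fun _ hn G hG => (hn G hG).imp_left fun hGK => hGK.trans hK

lemma turanDensity_le (hc : 0 ≤ c) (h : ForcedAbove c H H) : H.turanDensity ≤ c := by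
  refine le_of_forall_pos_le_add fun ε hε => le_of_tendsto H.tendsto_maxDensity ?_
  filter_upwards [h ε hε] with n hn
  refine H.maxDensity_le (by positivity) fun G hG => ?_
  by_contra! hlt
  exact hG ((or_self _).mp (hn G hlt))

lemma addTwin [Finite U] (h : ForcedAbove c K L) (u : U) : ForcedAbove c (K.addTwin u) L := by
  classical
  have := Fintype.ofFinite U
  intro ε hε
  obtain ⟨m, hforced, hm, hU⟩ := ((h (ε / 2) (by positivity)).and
    ((Filter.eventually_ge_atTop 2).and (Filter.eventually_ge_atTop (Fintype.card U)))).exists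
  have : Nonempty (U ↪ Fin m) := Function.Embedding.nonempty_of_card_le (by simpa using hU)
  let C : ℝ := (2 + |c + ε / 2|) * Fintype.card (U ↪ Fin m)
  have hC : 0 < C := by positivity
  filter_upwards [Filter.eventually_ge_atTop m,
    eventually_copyDensity_le K u (δ := ε / (2 * C)) (by positivity)] with n hmn hfew G hG
  by_contra! hfree
  have hdensity : G.density ≤ c + ε / 2 + C * K.copyDensity G := by
    rw [mul_assoc]
    refine density_le_add_copyDensity hm hmn fun e hK => ?_
    by_contra! hlt
    exact hfree.2 ((contains_comap e.injective G).trans ((hforced _ hlt).resolve_left hK))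
  have hcopies : C * K.copyDensity G ≤ ε / 2 :=
    calc C * K.copyDensity G ≤ C * (ε / (2 * C)) := by gcongr; exact hfew G hfree.1
      _ = ε / 2 := by field_simp
  linarith

lemma comap_sumElim [Finite U] [Finite V] (h : ForcedAbove c K L) (f : V → U) :
    ForcedAbove c (K.comap (Sum.elim id f)) L := by
  induction V using Finite.induction_empty_option with
  | of_equiv e ih =>
    have hf : Sum.elim id f = Sum.elim id (f ∘ e) ∘ Sum.map id e.symm := by
      ext (_ | _) <;> simp
    rw [hf, ← comap_comap]
    exact (ih (f ∘ e)).of_contains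
      (contains_comap (Function.injective_id.sumMap e.symm.injective) _)
  | h_empty =>
    exact h.of_contains (contains_comap (Function.injective_id.sumElim
      (Function.injective_of_subsingleton f) (by simp)) K)
  | @h_option V _ ih =>
    let g : U ⊕ Option V → Option (U ⊕ V) := Sum.elim (some ∘ Sum.inl) (Option.map Sum.inr)
    have hg : g.Injective :=
      ((Option.some_injective _).comp Sum.inl_injective).sumElim
        (Option.map_injective Sum.inr_injective) (by rintro u (_ | v) <;> simp)
    have hf : Sum.elim id f
        = (fun x => Sum.elim id (f ∘ some) (x.getD (Sum.inl (f none)))) ∘ g := by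
      ext (_ | _ | _) <;> rfl
    rw [hf, ← comap_comap]
    exact ((ih (f ∘ some)).addTwin (Sum.inl (f none))).of_contains (contains_comap hg _)

lemma of_colorableBy [Finite U] [Finite V] (h : ForcedAbove c K L) (hH : H.ColorableBy K) :
    ForcedAbove c H L := by
  obtain ⟨f, hf⟩ := hH
  exact (h.comap_sumElim f).of_contains ⟨Sum.inr, Sum.inr_injective, hf⟩

end ForcedAbove

end Supersaturation

section LocalDensity

lemma sum_weight_le_of_exists_low_degree {V : Type*} (G : TwoColoredGraph V) {c C : ℝ}
    (hlow : ∀ S : Finset V, S.Nonempty → ∃ x ∈ S, ∑ y ∈ S, (G.weight x y : ℝ) ≤ c * #S + C)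
    (S : Finset V) :
    ∑ x ∈ S, ∑ y ∈ S, (G.weight x y : ℝ) ≤ c * (#S : ℝ) ^ 2 + (2 * C + c) * #S := by
  classical
  induction hk : #S generalizing S with
  | zero => simp [card_eq_zero.1 hk]
  | succ k ih =>
    obtain ⟨x, hx, hdeg⟩ := hlow S (card_pos.1 (by lia))
    have hrest := ih (S.erase x) (by rw [card_erase_of_mem hx, hk, Nat.add_sub_cancel])
    have hxx : ∑ y ∈ S, (G.weight x y : ℝ) = ∑ y ∈ S.erase x, (G.weight x y : ℝ) := by
      simp [← add_sum_erase S _ hx]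
    have hsplit : ∑ z ∈ S, ∑ y ∈ S, (G.weight z y : ℝ)
        = 2 * ∑ y ∈ S, (G.weight x y : ℝ)
          + ∑ z ∈ S.erase x, ∑ y ∈ S.erase x, (G.weight z y : ℝ) := by
      rw [← add_sum_erase S _ hx,
        sum_congr rfl fun z _ => (add_sum_erase S (fun y => (G.weight z y : ℝ)) hx).symm,
        sum_add_distrib, hxx]
      simp only [G.weight_comm _ x]
      ring
    rw [hsplit]
    rw [hk] at hdeg
    push_cast at hdeg hrest ⊢
    linarith

lemma forcedAbove_of_min_degree {V W : Type*} {c C : ℝ}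
    {K₁ : TwoColoredGraph V} {K₂ : TwoColoredGraph W}
    (h : ∀ (n : ℕ) (G : TwoColoredGraph (Fin n)) (S : Finset (Fin n)), S.Nonempty →
      (∀ x ∈ S, c * #S + C < ∑ y ∈ S, (G.weight x y : ℝ)) → G.Contains K₁ ∨ G.Contains K₂) :
    ForcedAbove c K₁ K₂ := by
  intro ε hε
  obtain ⟨N, hN⟩ := exists_nat_ge ((2 * C + 2 * c + ε) / ε)
  filter_upwards [Filter.eventually_ge_atTop N, Filter.eventually_ge_atTop 2] with n hnN hn2 G hG
  by_contra hfree
  have hsum := G.sum_weight_le_of_exists_low_degree (c := c) (C := C) (fun S hS => by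
    by_contra! hdeg
    exact hfree (h n G S hS hdeg)) univ
  rw [card_univ, Fintype.card_fin] at hsum
  have hn2' : (2 : ℝ) ≤ n := by exact_mod_cast hn2
  have hlarge : 2 * C + 2 * c + ε ≤ n * ε :=
    (div_le_iff₀ hε).1 (hN.trans (by exact_mod_cast hnN))
  rw [density_eq_sum_div, lt_div_iff₀ (mul_pos (by linarith) (by linarith))] at hG
  have hmul : n * (2 * C + 2 * c + ε) ≤ n * (n * ε) := by gcongr
  linarith

/-- The product of the red edge and the blue edge: two points are joined in red if their first
coordinates differ, and in blue if their second coordinates differ. -/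
def redBlueProduct : TwoColoredGraph (Bool × Bool) where
  red := (⊤ : SimpleGraph Bool).comap Prod.fst
  blue := (⊤ : SimpleGraph Bool).comap Prod.snd

/-- The join of a red edge (on the vertices `(true, _)`) and a blue edge (on the vertices
`(false, _)`), where vertices of different edges are joined in both colors. -/
def redBlueJoin : TwoColoredGraph (Bool × Bool) where
  red := SimpleGraph.fromRel fun x y => x.1 = true ∨ y.1 = true
  blue := SimpleGraph.fromRel fun x y => x.1 = false ∨ y.1 = false

variable {V : Type*} {G : TwoColoredGraph V}

section Containment

variable {a b c d : V}

lemma contains_of_isHom {W : Type*} {K : TwoColoredGraph W} {f : W → V}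
    (hadj : ∀ x y, x ≠ y → K.red.Adj x y ∨ K.blue.Adj x y) (hf : K.IsHom G f) :
    G.Contains K := by
  refine ⟨f, fun x y hxy => ?_, hf⟩
  by_contra hne
  rcases hadj x y hne with h | h
  · exact (hf.1 _ _ h).ne hxy
  · exact (hf.2 _ _ h).ne hxy

lemma contains_redBlueProduct (hab : 2 ≤ G.weight a b) (hcd : 2 ≤ G.weight c d)
    (had : G.red.Adj a d) (hbc : G.red.Adj b c) (hac : G.blue.Adj a c) (hbd : G.blue.Adj b d) :
    G.Contains redBlueProduct := by
  rw [two_le_weight] at hab hcd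
  refine contains_of_isHom (f := fun x => cond x.1 (cond x.2 b d) (cond x.2 c a)) ?_ ⟨?_, ?_⟩
  · rintro ⟨_ | _, _ | _⟩ ⟨_ | _, _ | _⟩ <;> simp [redBlueProduct]
  · rintro ⟨_ | _, _ | _⟩ ⟨_ | _, _ | _⟩ <;>
      simp [redBlueProduct, hab, hcd, had, hbc, SimpleGraph.adj_comm]
  · rintro ⟨_ | _, _ | _⟩ ⟨_ | _, _ | _⟩ <;>
      simp [redBlueProduct, hab, hcd, hac, hbd, SimpleGraph.adj_comm]

lemma contains_redBlueProduct_of_weight (hab : 1 ≤ G.weight a b) (hac : 2 ≤ G.weight a c)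
    (had : 2 ≤ G.weight a d) (hbc : 2 ≤ G.weight b c) (hbd : 2 ≤ G.weight b d)
    (hcd : 2 ≤ G.weight c d) : G.Contains redBlueProduct := by
  have hbd' := G.weight_comm b d ▸ hbd
  have had' := G.two_le_weight.1 had
  have hbc' := G.two_le_weight.1 hbc
  have hcd' := G.two_le_weight.1 hcd
  rcases G.one_le_weight.1 hab with h | h
  · exact contains_redBlueProduct hac hbd' h hcd'.1 had'.2 hbc'.2.symm
  · exact contains_redBlueProduct hac hbd had'.1 hbc'.1.symm h hcd'.2

lemma contains_redBlueJoin (hab : G.red.Adj a b) (hcd : G.blue.Adj c d)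
    (hac : 2 ≤ G.weight a c) (had : 2 ≤ G.weight a d) (hbc : 2 ≤ G.weight b c)
    (hbd : 2 ≤ G.weight b d) : G.Contains redBlueJoin := by
  rw [two_le_weight] at hac had hbc hbd
  refine contains_of_isHom (f := fun x => cond x.1 (cond x.2 a b) (cond x.2 c d)) ?_ ⟨?_, ?_⟩
  · rintro ⟨_ | _, _ | _⟩ ⟨_ | _, _ | _⟩ <;> simp [redBlueJoin]
  · rintro ⟨_ | _, _ | _⟩ ⟨_ | _, _ | _⟩ <;>
      simp [redBlueJoin, hab, hac, had, hbc, hbd, SimpleGraph.adj_comm]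
  · rintro ⟨_ | _, _ | _⟩ ⟨_ | _, _ | _⟩ <;>
      simp [redBlueJoin, hcd, hac, had, hbc, hbd, SimpleGraph.adj_comm]

lemma contains_T (hab : 2 ≤ G.weight a b) (hac : G.red.Adj a c) (hbc : G.blue.Adj b c)
    (hcd : 2 ≤ G.weight c d) (hda : d ≠ a) (hdb : d ≠ b) : G.Contains T := by
  rw [two_le_weight] at hab hcd
  have hinj : Function.Injective ![a, b, c, d] := by
    simp [Function.Injective, Fin.forall_fin_succ, hab.1.ne, hab.1.ne', hac.ne, hac.ne', hbc.ne,
      hbc.ne', hcd.1.ne, hcd.1.ne', hda, hda.symm, hdb, hdb.symm]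
  refine ⟨![a, b, c, d], hinj, fun x y => ?_, fun x y => ?_⟩ <;> fin_cases x <;> fin_cases y <;>
    simp [T, hab, hcd, hac, hbc, SimpleGraph.adj_comm]

end Containment

variable {S : Finset V} {c : ℝ}

lemma exists_lt_sum_weight {ι : Type*} [Fintype ι] [Nonempty ι] {m : ℕ}
    (hm : m ≤ Fintype.card ι * c) {f : ι → V}
    (hdeg : ∀ i, c * #S < ∑ y ∈ S, (G.weight (f i) y : ℝ)) :
    ∃ y ∈ S, m < ∑ i, G.weight (f i) y := by
  have hsum : ∑ _y ∈ S, (m : ℝ) < ∑ y ∈ S, ∑ i, (G.weight (f i) y : ℝ) :=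
    calc ∑ _y ∈ S, (m : ℝ) = #S * m := by rw [sum_const, nsmul_eq_mul]
      _ ≤ #S * (Fintype.card ι * c) := by gcongr
      _ = ∑ _i : ι, c * #S := by rw [sum_const, card_univ, nsmul_eq_mul]; ring
      _ < ∑ i, ∑ y ∈ S, (G.weight (f i) y : ℝ) :=
        sum_lt_sum_of_nonempty univ_nonempty fun i _ => hdeg i
      _ = ∑ y ∈ S, ∑ i, (G.weight (f i) y : ℝ) := sum_comm
  obtain ⟨y, hy, hlt⟩ := exists_lt_of_sum_lt hsum
  exact ⟨y, hy, by exact_mod_cast hlt⟩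

lemma exists_notMem_two_le_weight {A : Finset V} {x : V}
    (hx : #S + #A < ∑ y ∈ S, G.weight x y) : ∃ y ∈ S, y ∉ A ∧ 2 ≤ G.weight x y := by
  classical
  by_contra! hlt
  refine hx.not_ge ?_
  calc ∑ y ∈ S, G.weight x y ≤ ∑ y ∈ S, (1 + if y ∈ A then 1 else 0) :=
        sum_le_sum fun y hy => by
          split_ifs with hyA
          · exact G.weight_le_two x y
          · exact Nat.le_of_lt_succ (hlt y hy hyA)
    _ = #S + #{y ∈ S | y ∈ A} := by rw [sum_add_distrib, ← card_eq_sum_ones, card_filter]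
    _ ≤ #S + #A := by
      gcongr
      exact fun y hy => (mem_filter.1 hy).2

lemma exists_two_le_weight (hc : 1 ≤ c) {x : V}
    (hx : c * #S < ∑ y ∈ S, (G.weight x y : ℝ)) : ∃ y ∈ S, 2 ≤ G.weight x y := by
  obtain ⟨y, hy, hxy⟩ := exists_lt_sum_weight (f := fun _ : Unit => x) (m := 1) (by simpa)
    fun _ => hx
  exact ⟨y, hy, by simpa [Nat.lt_iff_add_one_le] using hxy⟩

lemma exists_lt_weight_add_weight {m : ℕ} (hm : m ≤ 2 * c)
    (hdeg : ∀ x ∈ S, c * #S < ∑ y ∈ S, (G.weight x y : ℝ)) {x y : V} (hx : x ∈ S) (hy : y ∈ S) :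
    ∃ z ∈ S, m < G.weight x z + G.weight y z := by
  simpa using exists_lt_sum_weight (f := ![x, y]) (by simpa)
    (by simp [Fin.forall_fin_two, hdeg x hx, hdeg y hy])

lemma exists_five_le_weight_add_weight_add_weight (hc : 4 / 3 ≤ c)
    (hdeg : ∀ x ∈ S, c * #S < ∑ y ∈ S, (G.weight x y : ℝ)) {x y z : V} (hx : x ∈ S) (hy : y ∈ S)
    (hz : z ∈ S) : ∃ w ∈ S, 5 ≤ G.weight x w + G.weight y w + G.weight z w := by
  simpa [Fin.sum_univ_three, Nat.lt_iff_add_one_le] using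
    exists_lt_sum_weight (f := ![x, y, z]) (m := 4) (by norm_num; linarith)
      (by simp [Fin.forall_fin_succ, hdeg x hx, hdeg y hy, hdeg z hz])

lemma exists_triangle (hc : 1 ≤ c) (hS : S.Nonempty)
    (hdeg : ∀ x ∈ S, c * #S < ∑ y ∈ S, (G.weight x y : ℝ)) :
    ∃ p ∈ S, ∃ q ∈ S, ∃ r ∈ S,
      2 ≤ G.weight p q ∧ 2 ≤ G.weight p r ∧ 1 ≤ G.weight q r := by
  obtain ⟨x, hx⟩ := hS
  obtain ⟨y, hy, hxy⟩ := exists_two_le_weight hc (hdeg x hx)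
  obtain ⟨z, hz, hxyz⟩ := exists_lt_weight_add_weight (m := 2) (by norm_num; linarith) hdeg hx hy
  have := G.weight_le_two x z
  have := G.weight_le_two y z
  by_cases hxz : 2 ≤ G.weight x z
  · exact ⟨x, hx, y, hy, z, hz, hxy, hxz, by lia⟩
  · exact ⟨y, hy, x, hx, z, hz, by rwa [weight_comm], by lia, by lia⟩

lemma contains_redBlueProduct_of_double_triangle (hc : 4 / 3 ≤ c)
    (hdeg : ∀ x ∈ S, c * #S < ∑ y ∈ S, (G.weight x y : ℝ)) {x y z : V} (hx : x ∈ S) (hy : y ∈ S)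
    (hz : z ∈ S) (hxy : 2 ≤ G.weight x y) (hxz : 2 ≤ G.weight x z) (hyz : 2 ≤ G.weight y z) :
    G.Contains redBlueProduct := by
  obtain ⟨w, -, hw⟩ := exists_five_le_weight_add_weight_add_weight hc hdeg hx hy hz
  have := G.weight_le_two x w
  have := G.weight_le_two y w
  have := G.weight_le_two z w
  have hyx := G.weight_comm x y ▸ hxy
  have hzx := G.weight_comm x z ▸ hxz
  have hzy := G.weight_comm y z ▸ hyz
  simp only [G.weight_comm _ w] at *
  by_cases hwx : 2 ≤ G.weight w x
  · by_cases hwy : 2 ≤ G.weight w y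
    · exact contains_redBlueProduct_of_weight (by lia) hwx hwy hzx hzy hxy
    · exact contains_redBlueProduct_of_weight (by lia) hwx (by lia) hyx hyz hxz
  · exact contains_redBlueProduct_of_weight (a := w) (by lia) (by lia) (by lia) hxy hxz hyz

theorem forcedAbove_three_halves : ForcedAbove (3 / 2) redBlueProduct redBlueProduct := by
  refine forcedAbove_of_min_degree (C := 0) fun n G S ⟨x, hx⟩ hdeg => Or.inl ?_
  simp only [add_zero] at hdeg
  obtain ⟨y, hy, hxy⟩ := exists_two_le_weight (by norm_num) (hdeg x hx)
  obtain ⟨z, hz, hxyz⟩ := exists_lt_weight_add_weight (m := 3) (by norm_num) hdeg hx hy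
  have := G.weight_le_two x z
  have := G.weight_le_two y z
  exact contains_redBlueProduct_of_double_triangle (by norm_num) hdeg hx hy hz hxy (by lia)
    (by lia)

/-- The 4-cycle `p`, `q`, `w`, `r` is doubled; the colors of its two diagonals decide which
graph appears. -/
lemma contains_redBlueProduct_or_redBlueJoin {p q r w : V} (hpq : 2 ≤ G.weight p q)
    (hpr : 2 ≤ G.weight p r) (hqw : 2 ≤ G.weight q w) (hrw : 2 ≤ G.weight r w)
    (hqr : 1 ≤ G.weight q r) (hpw : 1 ≤ G.weight p w) :
    G.Contains redBlueProduct ∨ G.Contains redBlueJoin := by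
  have hpr' := G.two_le_weight.1 hpr
  have hqw' := G.two_le_weight.1 hqw
  have hqp := G.weight_comm p q ▸ hpq
  have hrp := G.weight_comm p r ▸ hpr
  have hwq := G.weight_comm q w ▸ hqw
  have hwr := G.weight_comm r w ▸ hrw
  rcases G.one_le_weight.1 hqr with hqr | hqr <;> rcases G.one_le_weight.1 hpw with hpw | hpw
  · exact Or.inl (contains_redBlueProduct hpq hrw hpw hqr hpr'.2 hqw'.2)
  · exact Or.inr (contains_redBlueJoin hqr hpw hqp hqw hrp hrw)
  · exact Or.inr (contains_redBlueJoin hpw hqr hpq hpr hwq hwr)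
  · exact Or.inl (contains_redBlueProduct hpq hwr hpr'.1 hqw'.1 hpw hqr)

theorem forcedAbove_four_thirds : ForcedAbove (4 / 3) redBlueProduct redBlueJoin := by
  refine forcedAbove_of_min_degree (C := 0) fun n G S hS hdeg => ?_
  simp only [add_zero] at hdeg
  obtain ⟨p, hp, q, hq, r, hr, hpq, hpr, hqr⟩ := exists_triangle (by norm_num) hS hdeg
  obtain ⟨w, hw, hpqr⟩ :=
    exists_five_le_weight_add_weight_add_weight (by norm_num) hdeg hp hq hr
  have := G.weight_le_two p w
  have := G.weight_le_two q w
  have := G.weight_le_two r w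
  by_cases hpw : 2 ≤ G.weight p w
  · left
    by_cases hqw : 2 ≤ G.weight q w
    · exact contains_redBlueProduct_of_double_triangle (by norm_num) hdeg hp hq hw hpq hpw hqw
    · exact contains_redBlueProduct_of_double_triangle (by norm_num) hdeg hp hr hw hpr hpw
        (by lia)
  · exact contains_redBlueProduct_or_redBlueJoin (w := w) hpq hpr (by lia) (by lia) hqr (by lia)

theorem forcedAbove_one : ForcedAbove 1 T T := by
  refine forcedAbove_of_min_degree (C := 2) fun n G S hS hdeg => Or.inl ?_
  obtain ⟨p, -, q, -, r, hr, hpq, hpr, hqr⟩ := exists_triangle le_rfl hS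
    fun x hx => (lt_add_of_pos_right _ two_pos).trans (hdeg x hx)
  obtain ⟨d, -, hd, hrd⟩ : ∃ d ∈ S, d ∉ ({p, q} : Finset (Fin n)) ∧ 2 ≤ G.weight r d := by
    refine exists_notMem_two_le_weight ?_
    have hdegr : #S + 2 < ∑ y ∈ S, G.weight r y := by exact_mod_cast one_mul (#S : ℝ) ▸ hdeg r hr
    exact (Nat.add_le_add_left card_le_two _).trans_lt hdegr
  obtain ⟨hdp, hdq⟩ : d ≠ p ∧ d ≠ q := by simpa using hd
  rw [two_le_weight] at hpr
  rcases G.one_le_weight.1 hqr with hqr | hqr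
  · exact contains_T (G.weight_comm p q ▸ hpq) hqr hpr.2 hrd hdq hdp
  · exact contains_T hpq hpr.1 hqr hrd hdp hdq

end LocalDensity

section UpperBound

variable {V : Type*}

/-- Each step of the construction of `p.bypass` cuts off a closed walk which is a cycle or goes
back and forth along an edge, so it has even length. -/
lemma even_length_bypass_iff [DecidableEq V] {K : SimpleGraph V}
    (hK : ∀ (v : V) (c : K.Walk v v), c.IsCycle → ¬ Odd c.length) {u v : V} (p : K.Walk u v) :
    Even p.bypass.length ↔ Even p.length := by
  induction p with
  | nil => simp [SimpleGraph.Walk.bypass]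
  | @cons u w v huw p ih =>
    rw [SimpleGraph.Walk.bypass, SimpleGraph.Walk.length_cons, Nat.even_add_one, ← ih]
    split_ifs with hu
    · set q := p.bypass.takeUntil u hu
      have hq : q.IsPath := p.bypass_isPath.takeUntil hu
      have hodd : Odd q.length := by
        by_cases huw' : s(u, w) ∈ q.edges
        · rw [hq.length_eq_one_of_mem_edges (Sym2.eq_swap ▸ huw')]
          exact odd_one
        · have hcycle := hK u (q.cons huw) ((q.cons_isCycle_iff huw).2 ⟨hq, huw'⟩)
          rwa [SimpleGraph.Walk.length_cons, Nat.not_odd_iff_even, Nat.even_add_one,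
            Nat.not_even_iff_odd] at hcycle
      have hlen := congrArg SimpleGraph.Walk.length (p.bypass.take_spec hu)
      rw [SimpleGraph.Walk.length_append] at hlen
      rw [← hlen, Nat.even_add, iff_false_left (Nat.not_even_iff_odd.2 hodd), not_not]
    · rw [SimpleGraph.Walk.length_cons, Nat.even_add_one]

lemma exists_coloring_of_no_odd_cycle {K : SimpleGraph V}
    (hK : ∀ (v : V) (c : K.Walk v v), c.IsCycle → ¬ Odd c.length) : Nonempty (K.Coloring Bool) := by
  classical
  have h2 : K.Colorable 2 := SimpleGraph.two_colorable_iff_forall_loop_even.2 fun u w => by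
    rw [← even_length_bypass_iff hK, (SimpleGraph.Walk.isPath_iff_nil.1 w.bypass_isPath).eq_nil]
    simp
  exact ⟨h2.toColoring (by simp)⟩

lemma Bipartite.colorableBy_redBlueProduct {H : TwoColoredGraph V} (hH : H.Bipartite) :
    H.ColorableBy redBlueProduct := by
  obtain ⟨r⟩ := exists_coloring_of_no_odd_cycle hH.1
  obtain ⟨b⟩ := exists_coloring_of_no_odd_cycle hH.2
  exact ⟨fun v => (r v, b v), fun _ _ h => r.valid h, fun _ _ h => b.valid h⟩

lemma H₈_colorableBy_redBlueProduct : H₈.ColorableBy redBlueProduct := by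
  let r : Fin 8 → Bool := ![false, true, true, false, false, true, false, true]
  let b : Fin 8 → Bool := ![true, false, true, false, false, true, true, false]
  have hr : ∀ u v, H₈.red.Adj u v → r u ≠ r v := by decide
  have hb : ∀ u v, H₈.blue.Adj u v → b u ≠ b v := by decide
  exact ⟨fun v => (r v, b v), hr, hb⟩

lemma H₈_colorableBy_redBlueJoin : H₈.ColorableBy redBlueJoin := by
  let s : Fin 8 → Bool := ![true, true, true, true, false, false, false, false]
  let t : Fin 8 → Bool := ![false, true, true, false, false, true, true, false]
  have hred : ∀ u v, H₈.red.Adj u v → (s u, t u) ≠ (s v, t v) ∧ (s u = true ∨ s v = true) := by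
    decide
  have hblue : ∀ u v, H₈.blue.Adj u v →
      (s u, t u) ≠ (s v, t v) ∧ (s u = false ∨ s v = false) := by
    decide
  exact ⟨fun v => (s v, t v), fun u v h => (hred u v h).imp_right Or.inl,
    fun u v h => (hblue u v h).imp_right Or.inl⟩

variable [Finite V] {H : TwoColoredGraph V}

lemma turanDensity_le_of_forcedAbove {U W : Type*} [Finite U] [Finite W] {c : ℝ} (hc : 0 ≤ c)
    {K : TwoColoredGraph U} {L : TwoColoredGraph W} (h : ForcedAbove c K L)
    (hK : H.ColorableBy K) (hL : H.ColorableBy L) : H.turanDensity ≤ c :=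
  ((h.of_colorableBy hK).symm.of_colorableBy hL).turanDensity_le hc

lemma turanDensity_le_one (hH : H.ColorableBy T) : H.turanDensity ≤ 1 :=
  turanDensity_le_of_forcedAbove (by norm_num) forcedAbove_one hH hH

lemma turanDensity_le_four_thirds (hH : H.ColorableBy H₈) : H.turanDensity ≤ 4 / 3 :=
  turanDensity_le_of_forcedAbove (by norm_num) forcedAbove_four_thirds
    (hH.trans H₈_colorableBy_redBlueProduct) (hH.trans H₈_colorableBy_redBlueJoin)

lemma turanDensity_le_three_halves (hH : H.Bipartite) : H.turanDensity ≤ 3 / 2 :=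
  turanDensity_le_of_forcedAbove (by norm_num) forcedAbove_three_halves
    hH.colorableBy_redBlueProduct hH.colorableBy_redBlueProduct

end UpperBound

end TwoColoredGraph

open TwoColoredGraph in
theorem theorem1p2_general {V : Type*} [Finite V] (H : TwoColoredGraph V)
    (hH : H.red.edgeSet.Nonempty ∨ H.blue.edgeSet.Nonempty) :
    Filter.Tendsto H.maxDensity Filter.atTop (nhds H.turanDensity) ∧
    (H.turanDensity = 1 ↔ H.ColorableBy T) ∧
    (H.turanDensity = 4 / 3 ↔ H.ColorableBy H₈ ∧ ¬ H.ColorableBy T) ∧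
    (H.Bipartite → (H.turanDensity = 3 / 2 ↔ ¬ H.ColorableBy H₈)) := by
  have hT : H.ColorableBy T → H.turanDensity = 1 := fun h =>
    (turanDensity_le_one h).antisymm (H.one_le_turanDensity hH)
  have hT' := H.four_thirds_le_turanDensity
  have hH₈ : H.ColorableBy H₈ → H.turanDensity ≤ 4 / 3 := turanDensity_le_four_thirds
  have hH₈' := H.three_halves_le_turanDensity
  refine ⟨H.tendsto_maxDensity, ⟨fun h => ?_, hT⟩, ⟨fun h => ⟨?_, fun hc => ?_⟩,
    fun ⟨h₈, h⟩ => (hH₈ h₈).antisymm (hT' h)⟩, fun hB => ⟨fun h hc => ?_,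
    fun h => (turanDensity_le_three_halves hB).antisymm (hH₈' h)⟩⟩
  · by_contra hc
    linarith [hT' hc]
  · by_contra hc
    linarith [hH₈' hc]
  · linarith [hT hc]
  · linarith [hH₈ hc]

theorem theorem1p2 {V : Type*} [Finite V] (H : TwoColoredGraph V) (hH : H.Proper) :
    Filter.Tendsto H.maxDensity Filter.atTop (nhds H.turanDensity) ∧
    (H.Bipartite →
      H.turanDensity = 1 ∨ H.turanDensity = 4 / 3 ∨ H.turanDensity = 3 / 2) ∧
    (H.Degenerate ↔ H.ColorableBy TwoColoredGraph.T) ∧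
    (H.turanDensity = 4 / 3 →
      H.ColorableBy TwoColoredGraph.H₈ ∧ ¬ H.ColorableBy TwoColoredGraph.T) ∧
    (H.Bipartite → H.turanDensity = 3 / 2 → ¬ H.ColorableBy TwoColoredGraph.H₈) := by
  obtain ⟨hlim, hT, hH₈, hB⟩ := theorem1p2_general H (Or.inl hH.1)
  exact ⟨hlim, by tauto, hT, hH₈.1, fun h => (hB h).1⟩
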